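/- Let $\mathfrak g$ be a real Lie algebra of finite even dimension $2n$ with an abelian ideal $\mathfrak n$ of codimension one, and let $(J,g)$ be a Hermitian structure on $\mathfrak g$: $J$ is an endomorphism of $\mathfrak g$ with $J^2=-\mathrm{Id}$ and vanishing Nijenhuis tensor, that is, $[JX,JY]-J[JX,Y]-J[X,JY]-[X,Y]=0$ for all $X,Y\in\mathfrak g$, and $g$ is a positive definite inner product on $\mathfrak g$ with $g(J\cdot,J\cdot)=g$. Identify elements and tensors on $\mathfrak g$ with left-invariant objects on the simply connected Lie group with Lie algebra $\mathfrak g$. Put $\mathfrak n_1=\mathfrak n\cap J\mathfrak n$ and $\omega=g(J\cdot,\cdot)$, let $\theta=-d^*\omega\circ J$ be the Lee form, where $d^*\omega=-\sum_i(\nabla_{f_i}\omega)(f_i,\cdot)$ for the Levi-Civita connection $\nabla$ of $g$ and any $g$-orthonormal basis $(f_i)$ of $\mathfrak g$, and call $(\mathfrak g,J,g)$ locally conformally balanced (LCB) if $d\theta=0$, where $d\theta(X,Y)=-\theta([X,Y])$. Let $\nabla^B$ be the Bismut connection, i.e. the unique connection with $\nabla^Bg=0$, $\nabla^BJ=0$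 and totally skew-symmetric torsion, let $R^B(X,Y)=[\nabla^B_X,\nabla^B_Y]-\nabla^B_{[X,Y]}$ be its curvature, and let $$\rho^B(X,Y)=-\tfrac12\sum_{i=1}^{2n}g\bigl(R^B(X,Y)f_i,Jf_i\bigr),\qquad X,Y\in\mathfrak g,$$ be its Bismut-Ricci form. Then the following are equivalent: 1. $(\mathfrak g,J,g)$ is LCB; 2. $\rho^B$ is of type $(1,1)$, i.e. $\rho^B(JX,JY)=\rho^B(X,Y)$ for all $X,Y\in\mathfrak g$; 3. $\rho^B(X,Y)=0$ for all $X\in\mathfrak n_1$ and $Y\in\mathfrak g$. -/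

import Mathlib

/-- A Hermitian structure `(J, g)` on a real Lie algebra: an integrable complex structure `J`
together with a positive definite inner product `g` for which `J` is an isometry. -/
structure HermitianStructure (𝔤 : Type*) [LieRing 𝔤] [LieAlgebra ℝ 𝔤] where
  /-- The complex structure. -/
  J : 𝔤 →ₗ[ℝ] 𝔤
  /-- The inner product. -/
  g : 𝔤 →ₗ[ℝ] 𝔤 →ₗ[ℝ] ℝ
  J_J : ∀ X, J (J X) = -X
  /-- The Nijenhuis tensor of `J` vanishes. -/
  integrable : ∀ X Y, ⁅J X, J Y⁆ - J ⁅J X, Y⁆ - J ⁅X, J Y⁆ - ⁅X, Y⁆ = 0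
  g_symm : ∀ X Y, g X Y = g Y X
  g_pos : ∀ X, X ≠ 0 → 0 < g X X
  g_J_J : ∀ X Y, g (J X) (J Y) = g X Y

namespace HermitianStructure

variable {𝔤 : Type*} [LieRing 𝔤] [LieAlgebra ℝ 𝔤]

/-- The fundamental form `ω = g(J·,·)`. -/
def fundamentalForm (H : HermitianStructure 𝔤) : 𝔤 →ₗ[ℝ] 𝔤 →ₗ[ℝ] ℝ :=
  H.g.comp H.J

/-- A basis is a `g`-orthonormal frame. -/
def IsOrthonormalFrame (H : HermitianStructure 𝔤) {ι : Type*} (f : Module.Basis ι ℝ 𝔤) : Prop :=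
  (∀ i, H.g (f i) (f i) = 1) ∧ ∀ i j, i ≠ j → H.g (f i) (f j) = 0

theorem exists_isOrthonormalFrame [Module.Finite ℝ 𝔤] (H : HermitianStructure 𝔤) :
    ∃ f : Module.Basis (Fin (Module.finrank ℝ 𝔤)) ℝ 𝔤, H.IsOrthonormalFrame f := by
  classical
  let c : InnerProductSpace.Core ℝ 𝔤 :=
    { inner := fun X Y => H.g X Y
      conj_inner_symm := fun X Y => by simp [H.g_symm X Y]
      re_inner_nonneg := fun X => by
        by_cases h : X = 0
        · simp [h]
        · simpa using (H.g_pos X h).le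
      add_left := fun X Y Z => by simp
      smul_left := fun X Y r => by simp
      definite := fun X hX => by
        by_contra h
        exact (H.g_pos X h).ne' hX }
  let _ : NormedAddCommGroup 𝔤 := c.toNormedAddCommGroup
  let _ : InnerProductSpace ℝ 𝔤 := InnerProductSpace.ofCore c.toCore
  let b := stdOrthonormalBasis ℝ 𝔤
  have key : ∀ i j, H.g (b i) (b j) = if i = j then 1 else 0 := fun i j =>
    (orthonormal_iff_ite.mp b.orthonormal) i j
  refine ⟨b.toBasis, fun i => ?_, fun i j hij => ?_⟩
  · simpa using key i i
  · simpa [hij] using key i j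

/-- A `g`-orthonormal frame. -/
noncomputable def frame [Module.Finite ℝ 𝔤] (H : HermitianStructure 𝔤) :
    Module.Basis (Fin (Module.finrank ℝ 𝔤)) ℝ 𝔤 :=
  H.exists_isOrthonormalFrame.choose

theorem isOrthonormalFrame_frame [Module.Finite ℝ 𝔤] (H : HermitianStructure 𝔤) :
    H.IsOrthonormalFrame H.frame :=
  H.exists_isOrthonormalFrame.choose_spec

theorem IsOrthonormalFrame.expand {H : HermitianStructure 𝔤} {ι : Type*} [Fintype ι]
    {f : Module.Basis ι ℝ 𝔤} (hf : H.IsOrthonormalFrame f) (X : 𝔤) :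
    X = ∑ i, H.g X (f i) • f i := by
  classical
  conv_lhs => rw [← f.sum_repr X]
  refine Finset.sum_congr rfl fun i _ => ?_
  congr 1
  conv_rhs => rw [← f.sum_repr X]
  rw [map_sum, LinearMap.sum_apply, Finset.sum_eq_single i]
  · simp [hf.1 i]
  · intro j _ hj
    simp [hf.2 j i hj]
  · simp

/-- Metric traces of bilinear maps do not depend on the orthonormal frame. -/
theorem IsOrthonormalFrame.sum_eq {H : HermitianStructure 𝔤} {ι κ : Type*} [Fintype ι] [Fintype κ]
    {f : Module.Basis ι ℝ 𝔤} {e : Module.Basis κ ℝ 𝔤}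
    (hf : H.IsOrthonormalFrame f) (he : H.IsOrthonormalFrame e) (B : 𝔤 →ₗ[ℝ] 𝔤 →ₗ[ℝ] ℝ) :
    ∑ i, B (f i) (f i) = ∑ j, B (e j) (e j) := by
  calc ∑ i, B (f i) (f i) = ∑ i, ∑ j, H.g (f i) (e j) * B (e j) (f i) := by
        refine Finset.sum_congr rfl fun i _ => ?_
        conv_lhs => rw [he.expand (f i)]
        conv_lhs => rw [← he.expand (f i)]
        conv_lhs => arg 1; rw [he.expand (f i)]
        simp
    _ = ∑ j, ∑ i, H.g (f i) (e j) * B (e j) (f i) := Finset.sum_comm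
    _ = ∑ j, B (e j) (e j) := by
        refine Finset.sum_congr rfl fun j _ => ?_
        conv_rhs => arg 2; rw [hf.expand (e j)]
        simp [H.g_symm]

theorem eq_of_g_eq (H : HermitianStructure 𝔤) {X Y : 𝔤} (h : ∀ Z, H.g X Z = H.g Y Z) : X = Y := by
  by_contra hne
  have h1 := H.g_pos (X - Y) (sub_ne_zero.mpr hne)
  have h2 := h (X - Y)
  have h3 : H.g (X - Y) (X - Y) = H.g X (X - Y) - H.g Y (X - Y) := by
    rw [map_sub H.g X Y, LinearMap.sub_apply]
  rw [h3, h2, sub_self] at h1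
  exact lt_irrefl _ h1

theorem g_J_left (H : HermitianStructure 𝔤) (X Y : 𝔤) : H.g (H.J X) Y = -H.g X (H.J Y) := by
  have h := H.g_J_J X (H.J Y)
  rw [H.J_J, map_neg] at h
  linarith

/-- A bilinear map with prescribed `g`-components. -/
theorem exists_connection [Module.Finite ℝ 𝔤] (H : HermitianStructure 𝔤)
    (T : 𝔤 →ₗ[ℝ] 𝔤 →ₗ[ℝ] 𝔤 →ₗ[ℝ] ℝ) :
    ∃ D : 𝔤 →ₗ[ℝ] 𝔤 →ₗ[ℝ] 𝔤, ∀ X Y Z, H.g (D X Y) Z = T X Y Z := by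
  refine ⟨LinearMap.mk₂ ℝ (fun X Y => ∑ i, T X Y (H.frame i) • H.frame i) ?_ ?_ ?_ ?_, ?_⟩
  · intro X X' Y; simp [add_smul, Finset.sum_add_distrib]
  · intro r X Y; simp [mul_smul, Finset.smul_sum]
  · intro X Y Y'; simp [add_smul, Finset.sum_add_distrib]
  · intro r X Y; simp [mul_smul, Finset.smul_sum]
  · intro X Y Z
    conv_rhs => rw [H.isOrthonormalFrame_frame.expand Z]
    simp [H.g_symm Z, mul_comm]

/-- A left-invariant connection, given by the bilinear map `D X Y = ∇_X Y`, is the Levi-Civita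
connection of `g`: it is metric and torsion-free. -/
structure IsLeviCivita (H : HermitianStructure 𝔤) (D : 𝔤 →ₗ[ℝ] 𝔤 →ₗ[ℝ] 𝔤) : Prop where
  metric : ∀ X Y Z, H.g (D X Y) Z + H.g Y (D X Z) = 0
  torsion : ∀ X Y, D X Y - D Y X - ⁅X, Y⁆ = 0

/-- The torsion of a left-invariant connection. -/
def torsion (D : 𝔤 →ₗ[ℝ] 𝔤 →ₗ[ℝ] 𝔤) (X Y : 𝔤) : 𝔤 := D X Y - D Y X - ⁅X, Y⁆

/-- A left-invariant connection is the Bismut connection of `(J, g)`: `∇g = 0`, `∇J = 0`, and the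
torsion is totally skew-symmetric (skew-symmetry in the first two arguments is automatic). -/
structure IsBismut (H : HermitianStructure 𝔤) (D : 𝔤 →ₗ[ℝ] 𝔤 →ₗ[ℝ] 𝔤) : Prop where
  metric : ∀ X Y Z, H.g (D X Y) Z + H.g Y (D X Z) = 0
  complex : ∀ X Y, D X (H.J Y) = H.J (D X Y)
  skew : ∀ X Y Z, H.g (torsion D X Y) Z = -H.g (torsion D X Z) Y

/-- The form `(X, Y, Z) ↦ g([X, Y], Z)`. -/
def structureForm (H : HermitianStructure 𝔤) : 𝔤 →ₗ[ℝ] 𝔤 →ₗ[ℝ] 𝔤 →ₗ[ℝ] ℝ :=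
  LinearMap.mk₂ ℝ (fun X Y => H.g ⁅X, Y⁆) (by intros; simp) (by intros; simp) (by intros; simp)
    (by intros; simp)

@[simp] theorem structureForm_apply (H : HermitianStructure 𝔤) (X Y Z : 𝔤) :
    H.structureForm X Y Z = H.g ⁅X, Y⁆ Z := rfl

/-- The Koszul formula. -/
theorem IsLeviCivita.koszul {H : HermitianStructure 𝔤} {D : 𝔤 →ₗ[ℝ] 𝔤 →ₗ[ℝ] 𝔤}
    (hD : H.IsLeviCivita D) (X Y Z : 𝔤) :
    2 * H.g (D X Y) Z = H.g ⁅X, Y⁆ Z - H.g ⁅Y, Z⁆ X + H.g ⁅Z, X⁆ Y := by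
  have t : ∀ U V W, H.g (D U V) W - H.g (D V U) W - H.g ⁅U, V⁆ W = 0 := by
    intro U V W
    have := congrArg (fun a => H.g a W) (hD.torsion U V)
    simpa using this
  have m : ∀ U V W, H.g (D U V) W + H.g (D U W) V = 0 := by
    intro U V W
    have := hD.metric U V W
    rwa [H.g_symm V] at this
  linarith [t X Y Z, t Y Z X, t Z X Y, m X Y Z, m Y Z X, m Z X Y]

theorem existsUnique_isLeviCivita [Module.Finite ℝ 𝔤] (H : HermitianStructure 𝔤) :
    ∃! D, H.IsLeviCivita D := by
  obtain ⟨D, hD⟩ := H.exists_connection (LinearMap.mk₂ ℝ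
    (fun X Y => (1 / 2 : ℝ) • (H.structureForm X Y - (H.structureForm Y).flip X
      + (H.structureForm.flip X).flip Y))
    (by intros; ext; simp; ring) (by intros; ext; simp; ring) (by intros; ext; simp; ring)
    (by intros; ext; simp; ring))
  have hD' : ∀ X Y Z, H.g (D X Y) Z = (1 / 2) * (H.g ⁅X, Y⁆ Z - H.g ⁅Y, Z⁆ X + H.g ⁅Z, X⁆ Y) := by
    intro X Y Z; rw [hD]; simp; ring
  have sk : ∀ U V W : 𝔤, H.g ⁅U, V⁆ W = -H.g ⁅V, U⁆ W := by
    intro U V W; rw [← lie_skew U V, map_neg, LinearMap.neg_apply]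
  refine ⟨D, ⟨fun X Y Z => ?_, fun X Y => H.eq_of_g_eq fun Z => ?_⟩, fun D' h' => ?_⟩
  · rw [H.g_symm Y, hD', hD']
    linarith [sk X Y Z, sk Y Z X, sk Z X Y]
  · simp only [map_sub, LinearMap.sub_apply, hD', map_zero, LinearMap.zero_apply]
    linarith [sk X Y Z, sk Y Z X, sk Z X Y]
  · ext X Y
    refine H.eq_of_g_eq fun Z => ?_
    have := h'.koszul X Y Z
    rw [hD']; linarith

/-- The Levi-Civita connection of `g`. -/
noncomputable def leviCivita [Module.Finite ℝ 𝔤] (H : HermitianStructure 𝔤) :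
    𝔤 →ₗ[ℝ] 𝔤 →ₗ[ℝ] 𝔤 :=
  H.existsUnique_isLeviCivita.choose

theorem isLeviCivita_leviCivita [Module.Finite ℝ 𝔤] (H : HermitianStructure 𝔤) :
    H.IsLeviCivita H.leviCivita :=
  H.existsUnique_isLeviCivita.choose_spec.1

theorem IsBismut.koszul {H : HermitianStructure 𝔤} {D : 𝔤 →ₗ[ℝ] 𝔤 →ₗ[ℝ] 𝔤}
    (hD : H.IsBismut D) (X Y Z : 𝔤) :
    2 * H.g (D X Y) Z = H.g ⁅X, Y⁆ Z - H.g ⁅Y, Z⁆ X + H.g ⁅Z, X⁆ Y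
      - H.g ⁅H.J X, H.J Y⁆ Z - H.g ⁅H.J Y, H.J Z⁆ X - H.g ⁅H.J Z, H.J X⁆ Y := by
  have t : ∀ U V W, H.g (torsion D U V) W = H.g (D U V) W - H.g (D V U) W - H.g ⁅U, V⁆ W := by
    intro U V W
    simp [torsion]
  have m : ∀ U V W, H.g (D U V) W + H.g (D U W) V = 0 := by
    intro U V W
    have := hD.metric U V W
    rwa [H.g_symm V] at this
  have c : ∀ U V W, H.g (D U (H.J V)) W = -H.g (D U V) (H.J W) := by
    intro U V W
    rw [hD.complex, H.g_J_left]
  have k : ∀ U V W, H.g (torsion D U V) W = -H.g (torsion D U W) V := hD.skew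
  have a : ∀ U V W, H.g (torsion D U V) W = -H.g (torsion D V U) W := by
    intro U V W
    rw [t, t, ← lie_skew U V]
    simp only [map_neg, LinearMap.neg_apply]
    ring
  have n : H.g ⁅H.J X, H.J Y⁆ Z + H.g ⁅H.J X, Y⁆ (H.J Z) + H.g ⁅X, H.J Y⁆ (H.J Z)
      - H.g ⁅X, Y⁆ Z = 0 := by
    have := congrArg (fun a => H.g a Z) (H.integrable X Y)
    simpa [H.g_J_left] using this
  have cJ : ∀ U V W, H.g (D U (H.J V)) (H.J W) = H.g (D U V) W := by
    intro U V W
    rw [hD.complex, H.g_J_J]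
  -- the torsion satisfies `c(X,Y,Z) = c(JX,JY,Z) + c(JX,Y,JZ) + c(X,JY,JZ)`
  have e : H.g (torsion D X Y) Z = H.g (torsion D (H.J X) (H.J Y)) Z
      + H.g (torsion D (H.J X) Y) (H.J Z) + H.g (torsion D X (H.J Y)) (H.J Z) := by
    rw [t, t, t, t]
    linarith [c (H.J X) Y Z, c (H.J Y) X Z, cJ X Y Z, cJ Y X Z]
  have f : H.g (torsion D (H.J X) (H.J Y)) Z + H.g (torsion D (H.J Y) (H.J Z)) X
      + H.g (torsion D (H.J Z) (H.J X)) Y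
      = -H.g ⁅H.J X, H.J Y⁆ Z - H.g ⁅H.J Y, H.J Z⁆ X - H.g ⁅H.J Z, H.J X⁆ Y := by
    rw [t, t, t]
    linarith [c (H.J X) Y Z, c (H.J Y) X Z, c (H.J Y) Z X, c (H.J Z) Y X, c (H.J Z) X Y,
      c (H.J X) Z Y, m (H.J X) Y (H.J Z), m (H.J Y) Z (H.J X), m (H.J Z) X (H.J Y)]
  linarith [t X Y Z, t Y Z X, t Z X Y, m X Y Z, m Y Z X, m Z X Y, k X Y Z, k Y Z X, k Z X Y,
    a X Y Z, a Y Z X, a Z X Y, e, f, k (H.J X) Y (H.J Z), a (H.J X) (H.J Z) Y,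
    k X (H.J Y) (H.J Z), a X (H.J Y) (H.J Z), k (H.J Y) X (H.J Z), a X (H.J Z) (H.J Y)]

theorem existsUnique_isBismut [Module.Finite ℝ 𝔤] (H : HermitianStructure 𝔤) :
    ∃! D, H.IsBismut D := by
  obtain ⟨D, hD⟩ := H.exists_connection (LinearMap.mk₂ ℝ
    (fun X Y => (1 / 2 : ℝ) • (H.structureForm X Y - (H.structureForm Y).flip X
      + (H.structureForm.flip X).flip Y - H.structureForm (H.J X) (H.J Y)
      - ((H.structureForm (H.J Y)).flip X).comp H.J
      - ((H.structureForm.flip (H.J X)).flip Y).comp H.J))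
    (by intros; ext; simp; ring) (by intros; ext; simp; ring) (by intros; ext; simp; ring)
    (by intros; ext; simp; ring))
  have hD' : ∀ X Y Z, H.g (D X Y) Z = (1 / 2) * (H.g ⁅X, Y⁆ Z - H.g ⁅Y, Z⁆ X + H.g ⁅Z, X⁆ Y
      - H.g ⁅H.J X, H.J Y⁆ Z - H.g ⁅H.J Y, H.J Z⁆ X - H.g ⁅H.J Z, H.J X⁆ Y) := by
    intro X Y Z; rw [hD]; simp
  have sk : ∀ U V W : 𝔤, H.g ⁅U, V⁆ W = -H.g ⁅V, U⁆ W := by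
    intro U V W; rw [← lie_skew U V, map_neg, LinearMap.neg_apply]
  have n : ∀ X Y Z, H.g ⁅H.J X, H.J Y⁆ Z + H.g ⁅H.J X, Y⁆ (H.J Z) + H.g ⁅X, H.J Y⁆ (H.J Z)
      - H.g ⁅X, Y⁆ Z = 0 := by
    intro X Y Z
    have := congrArg (fun a => H.g a Z) (H.integrable X Y)
    simpa [H.g_J_left] using this
  refine ⟨D, ⟨fun X Y Z => ?_, fun X Y => H.eq_of_g_eq fun Z => ?_, fun X Y Z => ?_⟩,
    fun D' h' => ?_⟩
  · rw [H.g_symm Y, hD', hD']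
    linarith [sk X Y Z, sk Y Z X, sk Z X Y, sk (H.J X) (H.J Y) Z, sk (H.J Y) (H.J Z) X,
      sk (H.J Z) (H.J X) Y]
  · rw [H.g_J_left, hD', hD']
    have n1 := n X Y (H.J Z)
    have n2 := n Z X (H.J Y)
    simp only [H.J_J, map_neg, neg_lie, lie_neg, LinearMap.neg_apply] at n1 n2 ⊢
    linarith
  · simp only [torsion, map_sub, LinearMap.sub_apply, hD']
    linarith [sk X Y Z, sk Y Z X, sk Z X Y, sk (H.J X) (H.J Y) Z, sk (H.J Y) (H.J Z) X,
      sk (H.J Z) (H.J X) Y]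
  · ext X Y
    refine H.eq_of_g_eq fun Z => ?_
    have := h'.koszul X Y Z
    rw [hD']; linarith

/-- The Bismut connection of `(J, g)`. -/
noncomputable def bismut [Module.Finite ℝ 𝔤] (H : HermitianStructure 𝔤) :
    𝔤 →ₗ[ℝ] 𝔤 →ₗ[ℝ] 𝔤 :=
  H.existsUnique_isBismut.choose

theorem isBismut_bismut [Module.Finite ℝ 𝔤] (H : HermitianStructure 𝔤) : H.IsBismut H.bismut :=
  H.existsUnique_isBismut.choose_spec.1

/-- The curvature `R(X, Y) = [∇_X, ∇_Y] - ∇_[X, Y]` of a left-invariant connection. -/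
def curvature (D : 𝔤 →ₗ[ℝ] 𝔤 →ₗ[ℝ] 𝔤) (X Y : 𝔤) : 𝔤 →ₗ[ℝ] 𝔤 :=
  D X ∘ₗ D Y - D Y ∘ₗ D X - D ⁅X, Y⁆

/-- The Bismut-Ricci form `ρ^B(X, Y) = -1/2 ∑ᵢ g(R^B(X, Y) fᵢ, J fᵢ)`. -/
noncomputable def bismutRicci [Module.Finite ℝ 𝔤] (H : HermitianStructure 𝔤) (X Y : 𝔤) : ℝ :=
  -(1 / 2) * ∑ i, H.g (curvature H.bismut X Y (H.frame i)) (H.J (H.frame i))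

/-- The covariant derivative `(∇_X α)(Y, Z) = -α(∇_X Y, Z) - α(Y, ∇_X Z)` of a left-invariant
2-form. -/
def covDeriv (D : 𝔤 →ₗ[ℝ] 𝔤 →ₗ[ℝ] 𝔤) (α : 𝔤 →ₗ[ℝ] 𝔤 →ₗ[ℝ] ℝ) (X Y Z : 𝔤) : ℝ :=
  -α (D X Y) Z - α Y (D X Z)

/-- The codifferential `(d^* α)(X) = -∑ᵢ (∇_{fᵢ} α)(fᵢ, X)` of a left-invariant 2-form, with `∇`
the Levi-Civita connection. -/
noncomputable def codifferential [Module.Finite ℝ 𝔤] (H : HermitianStructure 𝔤)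
    (α : 𝔤 →ₗ[ℝ] 𝔤 →ₗ[ℝ] ℝ) (X : 𝔤) : ℝ :=
  -∑ i, covDeriv H.leviCivita α (H.frame i) (H.frame i) X

/-- The Lee form `θ = -d^*ω ∘ J`. -/
noncomputable def leeForm [Module.Finite ℝ 𝔤] (H : HermitianStructure 𝔤) (X : 𝔤) : ℝ :=
  -H.codifferential H.fundamentalForm (H.J X)

/-- The exterior derivative `dα(X, Y) = -α([X, Y])` of a left-invariant 1-form. -/
def differential (α : 𝔤 → ℝ) (X Y : 𝔤) : ℝ := -α ⁅X, Y⁆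

/-- `(J, g)` is locally conformally balanced: `dθ = 0`. -/
def IsLCB [Module.Finite ℝ 𝔤] (H : HermitianStructure 𝔤) : Prop :=
  ∀ X Y, differential H.leeForm X Y = 0

/-- A 2-form is of type `(1,1)`: it is `J`-invariant. -/
def IsTypeOneOne (H : HermitianStructure 𝔤) (ρ : 𝔤 → 𝔤 → ℝ) : Prop :=
  ∀ X Y, ρ (H.J X) (H.J Y) = ρ X Y

/-- The maximal `J`-invariant subspace `𝔫 ∩ J𝔫` of `𝔫`. -/
def maximalInvariant (H : HermitianStructure 𝔤) (𝔫 : Submodule ℝ 𝔤) : Submodule ℝ 𝔤 :=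
  𝔫 ⊓ 𝔫.map H.J

/-- The Bismut-Ricci form may be computed in any orthonormal frame. -/
theorem bismutRicci_eq_sum [Module.Finite ℝ 𝔤] (H : HermitianStructure 𝔤) {ι : Type*} [Fintype ι]
    {f : Module.Basis ι ℝ 𝔤} (hf : H.IsOrthonormalFrame f) (X Y : 𝔤) :
    H.bismutRicci X Y = -(1 / 2) * ∑ i, H.g (curvature H.bismut X Y (f i)) (H.J (f i)) := by
  have := H.isOrthonormalFrame_frame.sum_eq hf
    ((H.g.comp (curvature H.bismut X Y)).compl₂ H.J)
  rw [bismutRicci]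
  congr 1

/-- The codifferential may be computed in any orthonormal frame. -/
theorem codifferential_eq_sum [Module.Finite ℝ 𝔤] (H : HermitianStructure 𝔤) {ι : Type*}
    [Fintype ι] {f : Module.Basis ι ℝ 𝔤} (hf : H.IsOrthonormalFrame f)
    (α : 𝔤 →ₗ[ℝ] 𝔤 →ₗ[ℝ] ℝ) (X : 𝔤) :
    H.codifferential α X = -∑ i, covDeriv H.leviCivita α (f i) (f i) X := by
  have := H.isOrthonormalFrame_frame.sum_eq hf (LinearMap.mk₂ ℝ
    (fun U V => covDeriv H.leviCivita α U V X) (by intros; simp [covDeriv]; ring)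
    (by intros; simp [covDeriv]; ring) (by intros; simp [covDeriv]; ring)
    (by intros; simp [covDeriv]; ring))
  rw [codifferential]
  congr 1

end HermitianStructure

/-! Let `N` be a unit normal of the ideal 𝔫. Since 𝔫 is abelian, the whole bracket is encoded by `ad
N` (`lie_eq`), and integrability makes `ad N` preserve 𝔫₁ = 𝔫 ∩ J𝔫 and commute with `J` there
(`lie_J`).

The Bismut connection commutes with `J`, so the commutator part of its curvature has no `J`-trace
and ρ^B(X, Y) = η([X, Y]) for a 1-form η (`bismutRicci_eq`). Both η and the Lee form θ are traces of
`ad` plus a multiple of pairing with Σ [fᵢ, J fᵢ], which here equals 2[N, JN]. The traces drop out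
where they are needed: θ = g([N, JN], J·) on 𝔫 and η = -g([N, JN], ·) on 𝔫₁.

Each of the three conditions thus becomes g([N, JN], [N, X]) = 0 for all X ∈ 𝔫₁. -/

namespace HermitianStructure

variable {𝔤 : Type*} [LieRing 𝔤] [LieAlgebra ℝ 𝔤]

/-! ### Metric traces and `J` -/

theorem IsOrthonormalFrame.trace_eq_sum {H : HermitianStructure 𝔤} {ι : Type*} [Fintype ι]
    {f : Module.Basis ι ℝ 𝔤} (hf : H.IsOrthonormalFrame f) (L : 𝔤 →ₗ[ℝ] 𝔤) :
    LinearMap.trace ℝ 𝔤 L = ∑ i, H.g (L (f i)) (f i) := by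
  classical
  rw [LinearMap.trace_eq_matrix_trace ℝ f L, Matrix.trace]
  refine Finset.sum_congr rfl fun i _ => ?_
  rw [Matrix.diag_apply, LinearMap.toMatrix_apply]
  conv_lhs => rw [hf.expand (L (f i))]
  simp [Finsupp.single_apply]

theorem IsOrthonormalFrame.trace_J_comp {H : HermitianStructure 𝔤} {ι : Type*} [Fintype ι]
    {f : Module.Basis ι ℝ 𝔤} (hf : H.IsOrthonormalFrame f) (L : 𝔤 →ₗ[ℝ] 𝔤) :
    LinearMap.trace ℝ 𝔤 (H.J ∘ₗ L) = -∑ i, H.g (L (f i)) (H.J (f i)) := by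
  rw [hf.trace_eq_sum]
  simp [H.g_J_left]

theorem J_comp_J (H : HermitianStructure 𝔤) : H.J ∘ₗ H.J = -LinearMap.id := by
  ext X; simp [H.J_J]

theorem trace_conj_J [Module.Finite ℝ 𝔤] (H : HermitianStructure 𝔤) (L : 𝔤 →ₗ[ℝ] 𝔤) :
    LinearMap.trace ℝ 𝔤 (H.J ∘ₗ L ∘ₗ H.J) = -LinearMap.trace ℝ 𝔤 L := by
  rw [LinearMap.trace_comp_comm', LinearMap.comp_assoc, J_comp_J, LinearMap.comp_neg, map_neg,
    LinearMap.comp_id]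

/-! ### The Bismut-Ricci and Lee forms through traces of `ad` -/

/-- The vector `∑ᵢ [fᵢ, J fᵢ]`. -/
noncomputable def bracketTrace [Module.Finite ℝ 𝔤] (H : HermitianStructure 𝔤) : 𝔤 :=
  ∑ i, ⁅H.frame i, H.J (H.frame i)⁆

/-- The 1-form whose pullback along the bracket is the Bismut-Ricci form. -/
noncomputable def ricciPotential [Module.Finite ℝ 𝔤] (H : HermitianStructure 𝔤) (Z : 𝔤) : ℝ :=
  (1 / 2) * (-LinearMap.trace ℝ 𝔤 (H.J ∘ₗ (LieAlgebra.ad ℝ 𝔤 Z : 𝔤 →ₗ[ℝ] 𝔤))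
    - H.g H.bracketTrace Z - LinearMap.trace ℝ 𝔤 (LieAlgebra.ad ℝ 𝔤 (H.J Z)))

/-- Koszul's formula with arguments fᵢ, J fᵢ. By cyclicity and invariance under conjugation by `J`,
the terms in `ad Z` pair up into tr(J ad Z), and those in `ad (JZ)` into tr ad(JZ). -/
theorem sum_g_bismut_J [Module.Finite ℝ 𝔤] (H : HermitianStructure 𝔤) (Z : 𝔤) :
    (1 / 2) * ∑ i, H.g (H.bismut Z (H.frame i)) (H.J (H.frame i)) = H.ricciPotential Z := by
  have hf := H.isOrthonormalFrame_frame
  have h1 := hf.trace_J_comp (LieAlgebra.ad ℝ 𝔤 Z : 𝔤 →ₗ[ℝ] 𝔤)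
  have h2 := hf.trace_eq_sum ((LieAlgebra.ad ℝ 𝔤 Z : 𝔤 →ₗ[ℝ] 𝔤) ∘ₗ H.J)
  have h3 := hf.trace_J_comp ((LieAlgebra.ad ℝ 𝔤 (H.J Z) : 𝔤 →ₗ[ℝ] 𝔤) ∘ₗ H.J)
  have h4 := hf.trace_eq_sum (LieAlgebra.ad ℝ 𝔤 (H.J Z) : 𝔤 →ₗ[ℝ] 𝔤)
  rw [trace_conj_J] at h3
  rw [← LinearMap.trace_comp_comm'] at h2
  have h5 : H.g H.bracketTrace Z = ∑ i, H.g ⁅H.frame i, H.J (H.frame i)⁆ Z := by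
    simp [bracketTrace]
  have key : 2 * ∑ i, H.g (H.bismut Z (H.frame i)) (H.J (H.frame i))
      = ∑ i, H.g ⁅Z, H.frame i⁆ (H.J (H.frame i))
        - 2 * ∑ i, H.g ⁅H.frame i, H.J (H.frame i)⁆ Z
        - ∑ i, H.g ⁅Z, H.J (H.frame i)⁆ (H.frame i)
        - ∑ i, H.g ⁅H.J Z, H.J (H.frame i)⁆ (H.J (H.frame i))
        - ∑ i, H.g ⁅H.J Z, H.frame i⁆ (H.frame i) := by
    simp only [Finset.mul_sum, ← Finset.sum_sub_distrib]
    refine Finset.sum_congr rfl fun i _ => ?_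
    rw [H.isBismut_bismut.koszul]
    have s1 := lie_skew (H.J (H.frame i)) (H.frame i)
    have s2 := lie_skew (H.J (H.frame i)) Z
    have s3 := lie_skew (H.frame i) (H.J Z)
    rw [H.J_J, ← s2]
    simp only [lie_neg, neg_lie, map_neg, LinearMap.neg_apply]
    rw [← s1, ← s3]
    simp only [map_neg, LinearMap.neg_apply]
    ring
  simp only [LinearMap.comp_apply, LieAlgebra.ad_apply] at h1 h2 h3 h4
  rw [ricciPotential, h5]
  linarith

/-- `J` moves past `A`, then the trace is cyclic. This kills the commutator part of the Bismut
curvature. -/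
theorem trace_J_comp_commute [Module.Finite ℝ 𝔤] (H : HermitianStructure 𝔤) {A B : 𝔤 →ₗ[ℝ] 𝔤}
    (hA : ∀ X, A (H.J X) = H.J (A X)) :
    LinearMap.trace ℝ 𝔤 (H.J ∘ₗ (A ∘ₗ B)) = LinearMap.trace ℝ 𝔤 (H.J ∘ₗ (B ∘ₗ A)) := by
  have : H.J ∘ₗ (A ∘ₗ B) = A ∘ₗ (H.J ∘ₗ B) := by
    ext X; simp [hA]
  rw [this, LinearMap.trace_comp_comm', LinearMap.comp_assoc]

theorem bismutRicci_eq [Module.Finite ℝ 𝔤] (H : HermitianStructure 𝔤) (X Y : 𝔤) :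
    H.bismutRicci X Y = H.ricciPotential ⁅X, Y⁆ := by
  have hf := H.isOrthonormalFrame_frame
  have h1 := hf.trace_J_comp (H.bismut X ∘ₗ H.bismut Y)
  have h2 := hf.trace_J_comp (H.bismut Y ∘ₗ H.bismut X)
  have h3 := H.trace_J_comp_commute (B := H.bismut Y) (H.isBismut_bismut.complex X)
  rw [bismutRicci, ← sum_g_bismut_J]
  simp only [curvature, LinearMap.sub_apply, map_sub, Finset.sum_sub_distrib]
  linarith

/-- In the Koszul expansion of ∇ω the two sums containing `ad (JX)` are tr(J ad(JX)) with opposite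
signs, so they cancel. -/
theorem leeForm_eq [Module.Finite ℝ 𝔤] (H : HermitianStructure 𝔤) (X : 𝔤) :
    H.leeForm X = -LinearMap.trace ℝ 𝔤 (LieAlgebra.ad ℝ 𝔤 X)
      + (1 / 2) * H.g H.bracketTrace (H.J X) := by
  have hf := H.isOrthonormalFrame_frame
  have h1 := hf.trace_J_comp (LieAlgebra.ad ℝ 𝔤 (H.J X) : 𝔤 →ₗ[ℝ] 𝔤)
  have h2 := hf.trace_eq_sum ((LieAlgebra.ad ℝ 𝔤 (H.J X) : 𝔤 →ₗ[ℝ] 𝔤) ∘ₗ H.J)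
  have h4 := hf.trace_eq_sum (LieAlgebra.ad ℝ 𝔤 X : 𝔤 →ₗ[ℝ] 𝔤)
  rw [← LinearMap.trace_comp_comm'] at h2
  have h5 : H.g H.bracketTrace (H.J X) = ∑ i, H.g ⁅H.frame i, H.J (H.frame i)⁆ (H.J X) := by
    simp [bracketTrace]
  have key : H.leeForm X = -∑ i, H.g ⁅X, H.frame i⁆ (H.frame i)
        + (1 / 2) * (∑ i, H.g ⁅H.J X, H.frame i⁆ (H.J (H.frame i))
        + ∑ i, H.g ⁅H.J X, H.J (H.frame i)⁆ (H.frame i)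
        + ∑ i, H.g ⁅H.frame i, H.J (H.frame i)⁆ (H.J X)) := by
    rw [leeForm, codifferential, neg_neg, ← Finset.sum_add_distrib, ← Finset.sum_add_distrib,
      Finset.mul_sum, ← Finset.sum_neg_distrib, ← Finset.sum_add_distrib]
    refine Finset.sum_congr rfl fun i _ => ?_
    have k1 := H.isLeviCivita_leviCivita.koszul (H.frame i) (H.frame i) X
    have k2 := H.isLeviCivita_leviCivita.koszul (H.frame i) (H.J X) (H.J (H.frame i))
    rw [← lie_skew (H.frame i) X, lie_self, map_zero, LinearMap.zero_apply] at k1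
    rw [← lie_skew (H.frame i) (H.J X), ← lie_skew (H.J (H.frame i)) (H.frame i)] at k2
    simp only [map_neg, LinearMap.neg_apply] at k1 k2
    simp only [covDeriv, fundamentalForm, LinearMap.comp_apply, H.g_J_J]
    rw [H.g_symm (H.J (H.frame i))]
    linarith
  simp only [LinearMap.comp_apply, LieAlgebra.ad_apply] at h1 h2 h4
  rw [key, h5]
  linarith

/-! ### The unit normal and the action of `ad N` on 𝔫₁ -/

/-- A unit normal vector of a hyperplane. -/
theorem exists_unit_normal [Module.Finite ℝ 𝔤] (H : HermitianStructure 𝔤) (𝔫 : Submodule ℝ 𝔤)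
    (h_codim : Module.finrank ℝ 𝔤 = Module.finrank ℝ 𝔫 + 1) :
    ∃ N, H.g N N = 1 ∧ ∀ X, X ∈ 𝔫 ↔ H.g X N = 0 := by
  have hlt : 𝔫 < ⊤ := by
    rw [lt_top_iff_ne_top]
    rintro rfl
    rw [finrank_top] at h_codim
    omega
  obtain ⟨φ, hφ, hle⟩ := Submodule.exists_le_ker_of_lt_top 𝔫 hlt
  have hker : 𝔫 = LinearMap.ker φ := by
    refine Submodule.eq_of_le_of_finrank_le hle ?_
    have := Module.Dual.finrank_ker_add_one_of_ne_zero hφ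
    omega
  -- The Riesz vector of a functional with kernel 𝔫, to be normalised.
  let M := ∑ i, φ (H.frame i) • H.frame i
  have hM : ∀ X, H.g X M = φ X := by
    intro X
    conv_rhs => rw [H.isOrthonormalFrame_frame.expand X]
    simp [M, mul_comm]
  have hM0 : M ≠ 0 := by
    intro h
    apply hφ
    ext X
    rw [← hM, h]; simp
  have hpos := H.g_pos M hM0
  have hs := Real.sqrt_pos.mpr hpos
  refine ⟨(Real.sqrt (H.g M M))⁻¹ • M, ?_, fun X => ?_⟩
  · simp only [map_smul, LinearMap.smul_apply, smul_eq_mul]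
    field_simp
    rw [Real.sq_sqrt hpos.le]
  · rw [hker, LinearMap.mem_ker, map_smul, smul_eq_mul, mul_eq_zero,
      or_iff_right (inv_ne_zero hs.ne'), hM]

theorem mem_maximalInvariant_iff (H : HermitianStructure 𝔤) {𝔫 : Submodule ℝ 𝔤} {X : 𝔤} :
    X ∈ H.maximalInvariant 𝔫 ↔ X ∈ 𝔫 ∧ H.J X ∈ 𝔫 := by
  simp only [maximalInvariant, Submodule.mem_inf, Submodule.mem_map]
  refine and_congr_right fun _ => ⟨?_, fun h => ⟨-H.J X, 𝔫.neg_mem h, by simp [H.J_J]⟩⟩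
  rintro ⟨Y, hY, rfl⟩
  rw [H.J_J]
  exact 𝔫.neg_mem hY

theorem g_self_J (H : HermitianStructure 𝔤) (X : 𝔤) : H.g X (H.J X) = 0 := by
  have := H.g_J_left X X
  rw [H.g_symm] at this
  linarith

/-- `N` is a `g`-unit normal of the abelian ideal `𝔫` of codimension one. -/
structure IsUnitNormal (H : HermitianStructure 𝔤) (𝔫 : LieIdeal ℝ 𝔤) (N : 𝔤) : Prop where
  abelian : ∀ X ∈ 𝔫, ∀ Y ∈ 𝔫, ⁅X, Y⁆ = 0
  unit : H.g N N = 1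
  mem_iff : ∀ X, X ∈ 𝔫 ↔ H.g X N = 0

namespace IsUnitNormal

variable {H : HermitianStructure 𝔤} {𝔫 : LieIdeal ℝ 𝔤} {N : 𝔤}

theorem sub_mem (hN : H.IsUnitNormal 𝔫 N) (X : 𝔤) : X - H.g X N • N ∈ 𝔫 := by
  rw [hN.mem_iff]; simp [hN.unit]

theorem J_mem (hN : H.IsUnitNormal 𝔫 N) : H.J N ∈ 𝔫 := by
  rw [hN.mem_iff, H.g_symm, g_self_J]

/-- The projections of `X` and `Y` to 𝔫 commute; expanding their bracket leaves only brackets with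
`N`. -/
theorem lie_eq (hN : H.IsUnitNormal 𝔫 N) (X Y : 𝔤) :
    ⁅X, Y⁆ = H.g X N • ⁅N, Y⁆ - H.g Y N • ⁅N, X⁆ := by
  have h := hN.abelian _ (hN.sub_mem X) _ (hN.sub_mem Y)
  simp only [sub_lie, lie_sub, smul_lie, lie_smul, lie_self, smul_zero, sub_zero] at h
  rw [← lie_skew X N, smul_neg, sub_neg_eq_add] at h
  rw [← sub_eq_zero, ← h]
  abel

theorem lie_eq_of_mem (hN : H.IsUnitNormal 𝔫 N) {X : 𝔤} (hX : X ∈ 𝔫) (Y : 𝔤) :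
    ⁅X, Y⁆ = -(H.g Y N • ⁅N, X⁆) := by
  rw [hN.lie_eq, (hN.mem_iff X).1 hX, zero_smul, zero_sub]

theorem lie_mem (hN : H.IsUnitNormal 𝔫 N) (X Y : 𝔤) : ⁅X, Y⁆ ∈ 𝔫 := by
  have h : ∀ Z, ⁅N, Z⁆ ∈ 𝔫 := fun Z => by
    have := lie_mem_right ℝ 𝔤 𝔫 N _ (hN.sub_mem Z)
    simpa using this
  rw [hN.lie_eq]
  exact 𝔫.sub_mem (𝔫.smul_mem _ (h Y)) (𝔫.smul_mem _ (h X))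

theorem mem_maximalInvariant (hN : H.IsUnitNormal 𝔫 N) (X : 𝔤) :
    X ∈ H.maximalInvariant 𝔫.toSubmodule ↔ H.g X N = 0 ∧ H.g X (H.J N) = 0 := by
  rw [mem_maximalInvariant_iff, LieSubmodule.mem_toSubmodule, LieSubmodule.mem_toSubmodule,
    hN.mem_iff, hN.mem_iff, H.g_J_left, neg_eq_zero]

theorem J_mem_maximalInvariant (hN : H.IsUnitNormal 𝔫 N) {X : 𝔤}
    (hX : X ∈ H.maximalInvariant 𝔫.toSubmodule) : H.J X ∈ H.maximalInvariant 𝔫.toSubmodule := by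
  rw [hN.mem_maximalInvariant] at hX ⊢
  rw [H.g_J_J, H.g_J_left, hX.1, hX.2]
  simp

theorem sub_mem_maximalInvariant (hN : H.IsUnitNormal 𝔫 N) (X : 𝔤) :
    X - H.g X N • N - H.g X (H.J N) • H.J N ∈ H.maximalInvariant 𝔫.toSubmodule := by
  rw [hN.mem_maximalInvariant]
  simp [hN.unit, H.g_J_J, g_self_J, H.g_symm (H.J N) N]

/-- In the Nijenhuis identity for (N, X), the brackets with `JN` are taken inside the abelian 𝔫 and
vanish. -/
theorem lie_J (hN : H.IsUnitNormal 𝔫 N) {X : 𝔤} (hX : X ∈ H.maximalInvariant 𝔫.toSubmodule) :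
    ⁅N, H.J X⁆ = H.J ⁅N, X⁆ := by
  obtain ⟨h1, h2⟩ := H.mem_maximalInvariant_iff.1 hX
  have h := H.integrable N X
  rw [hN.abelian _ hN.J_mem _ h2, hN.abelian _ hN.J_mem _ h1, map_zero, sub_zero, zero_sub] at h
  have h' := congrArg H.J h
  rw [map_sub, map_neg, H.J_J, neg_neg, map_zero] at h'
  exact sub_eq_zero.1 h'

theorem lie_mem_maximalInvariant (hN : H.IsUnitNormal 𝔫 N) {X : 𝔤}
    (hX : X ∈ H.maximalInvariant 𝔫.toSubmodule) : ⁅N, X⁆ ∈ H.maximalInvariant 𝔫.toSubmodule := by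
  rw [mem_maximalInvariant_iff, ← hN.lie_J hX]
  exact ⟨hN.lie_mem _ _, hN.lie_mem _ _⟩

/-! ### Traces, θ and η in terms of [N, JN] -/

variable [Module.Finite ℝ 𝔤]

theorem bracketTrace_eq (hN : H.IsUnitNormal 𝔫 N) : H.bracketTrace = (2 : ℝ) • ⁅N, H.J N⁆ := by
  have e1 := congrArg (fun X => ⁅N, H.J X⁆) (H.isOrthonormalFrame_frame.expand N)
  have e2 := congrArg (fun X => ⁅N, X⁆) (H.isOrthonormalFrame_frame.expand (H.J N))
  simp only [map_sum, map_smul, lie_sum, lie_smul] at e1 e2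
  rw [two_smul]
  -- One copy of [N, JN] expands `N` inside `J`, the other expands `JN`; they match the two terms of
  -- `lie_eq` for [fᵢ, J fᵢ].
  nth_rw 1 [e1]
  rw [e2, bracketTrace, ← Finset.sum_add_distrib]
  refine Finset.sum_congr rfl fun i _ => ?_
  rw [hN.lie_eq, H.g_J_left (H.frame i), H.g_symm N, H.g_symm (H.J N), neg_smul, sub_neg_eq_add]

/-- For Z ∈ 𝔫, `ad Z` is the rank-one map Y ↦ -g(Y, N)[N, Z]. -/
theorem trace_ad_comp (hN : H.IsUnitNormal 𝔫 N) {Z : 𝔤} (hZ : Z ∈ 𝔫) (L : 𝔤 →ₗ[ℝ] 𝔤) :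
    LinearMap.trace ℝ 𝔤 (L ∘ₗ (LieAlgebra.ad ℝ 𝔤 Z : 𝔤 →ₗ[ℝ] 𝔤)) = -H.g (L ⁅N, Z⁆) N := by
  rw [H.isOrthonormalFrame_frame.trace_eq_sum]
  conv_rhs => arg 1; arg 2; rw [H.isOrthonormalFrame_frame.expand N]
  rw [map_sum, ← Finset.sum_neg_distrib]
  refine Finset.sum_congr rfl fun i _ => ?_
  rw [LinearMap.comp_apply, LieAlgebra.ad_apply, hN.lie_eq_of_mem hZ, H.g_symm N]
  simp

theorem trace_ad (hN : H.IsUnitNormal 𝔫 N) {Z : 𝔤} (hZ : Z ∈ 𝔫) :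
    LinearMap.trace ℝ 𝔤 (LieAlgebra.ad ℝ 𝔤 Z) = 0 := by
  have := hN.trace_ad_comp hZ LinearMap.id
  rw [LinearMap.id_comp] at this
  rw [this, LinearMap.id_apply, (hN.mem_iff _).1 (hN.lie_mem N Z), neg_zero]

theorem leeForm_of_mem (hN : H.IsUnitNormal 𝔫 N) {X : 𝔤} (hX : X ∈ 𝔫) :
    H.leeForm X = H.g ⁅N, H.J N⁆ (H.J X) := by
  rw [leeForm_eq, hN.trace_ad hX, hN.bracketTrace_eq]
  simp

/-- Both traces vanish: JZ ∈ 𝔫, and J[N, Z] = [N, JZ] is orthogonal to `N`. -/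
theorem ricciPotential_of_mem (hN : H.IsUnitNormal 𝔫 N) {Z : 𝔤}
    (hZ : Z ∈ H.maximalInvariant 𝔫.toSubmodule) :
    H.ricciPotential Z = -H.g ⁅N, H.J N⁆ Z := by
  obtain ⟨h1, h2⟩ := H.mem_maximalInvariant_iff.1 hZ
  rw [ricciPotential, hN.trace_ad h2, hN.trace_ad_comp h1, hN.bracketTrace_eq, ← hN.lie_J hZ,
    (hN.mem_iff _).1 (hN.lie_mem N _)]
  simp

theorem bismutRicci_of_mem (hN : H.IsUnitNormal 𝔫 N) {X : 𝔤}
    (hX : X ∈ H.maximalInvariant 𝔫.toSubmodule) (Y : 𝔤) :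
    H.bismutRicci X Y = H.g Y N * H.g ⁅N, H.J N⁆ ⁅N, X⁆ := by
  rw [bismutRicci_eq, hN.lie_eq_of_mem (H.mem_maximalInvariant_iff.1 hX).1,
    hN.ricciPotential_of_mem (Submodule.neg_mem _ (Submodule.smul_mem _ _
      (hN.lie_mem_maximalInvariant hX)))]
  simp

/-! ### Reduction of the three conditions to one -/

/-- The locally conformally balanced condition in terms of the data `([N, JN], ad N)`. -/
theorem isLCB_iff (hN : H.IsUnitNormal 𝔫 N) :
    H.IsLCB ↔ ∀ X ∈ H.maximalInvariant 𝔫.toSubmodule, H.g ⁅N, H.J N⁆ ⁅N, X⁆ = 0 := by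
  have hd : ∀ X Y, differential H.leeForm X Y = -H.g ⁅N, H.J N⁆ (H.J ⁅X, Y⁆) := fun X Y => by
    rw [differential, hN.leeForm_of_mem (hN.lie_mem X Y)]
  refine ⟨fun h X hX => ?_, fun h X Y => ?_⟩
  · have := h N (H.J X)
    rw [hd, hN.lie_J hX, H.J_J, map_neg, neg_neg] at this
    exact this
  -- Only the 𝔫₁-component of `Y` needs the hypothesis: `N` contributes [N, N] = 0, and `JN`
  -- contributes g(V, JV) = 0 with V = [N, JN].
  · have hJ : ∀ Y, H.g ⁅N, H.J N⁆ (H.J ⁅N, Y⁆) = 0 := fun Y => by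
      have hm := hN.sub_mem_maximalInvariant Y
      have h' := h _ (hN.J_mem_maximalInvariant hm)
      rw [hN.lie_J hm] at h'
      simpa [g_self_J] using h'
    rw [hd, hN.lie_eq X Y, map_sub, map_sub, map_smul, map_smul, map_smul, map_smul, hJ, hJ]
    simp

theorem forall_bismutRicci_eq_zero_iff (hN : H.IsUnitNormal 𝔫 N) :
    (∀ X ∈ H.maximalInvariant 𝔫.toSubmodule, ∀ Y, H.bismutRicci X Y = 0) ↔
      ∀ X ∈ H.maximalInvariant 𝔫.toSubmodule, H.g ⁅N, H.J N⁆ ⁅N, X⁆ = 0 := by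
  refine ⟨fun h X hX => ?_, fun h X hX Y => ?_⟩
  · have := h X hX N
    rwa [hN.bismutRicci_of_mem hX, hN.unit, one_mul] at this
  · rw [hN.bismutRicci_of_mem hX, h X hX, mul_zero]

theorem isTypeOneOne_bismutRicci_iff (hN : H.IsUnitNormal 𝔫 N) :
    H.IsTypeOneOne H.bismutRicci ↔
      ∀ X ∈ H.maximalInvariant 𝔫.toSubmodule, H.g ⁅N, H.J N⁆ ⁅N, X⁆ = 0 := by
  refine ⟨fun h X hX => ?_, fun h X Y => ?_⟩
  -- As JN ∈ 𝔫, ρ^B(JX, JN) = 0, while ρ^B(X, N) = g([N, JN], [N, X]).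
  · have := h X N
    rw [hN.bismutRicci_of_mem hX, hN.bismutRicci_of_mem (hN.J_mem_maximalInvariant hX), hN.unit,
      (hN.mem_iff _).1 hN.J_mem] at this
    linarith
  · -- both sides are determined by the components of `X` and `Y` along `N` and `J N`
    have add : ∀ Z W, H.ricciPotential (Z + W) = H.ricciPotential Z + H.ricciPotential W := by
      intro Z W
      simp only [ricciPotential, map_add, LinearMap.comp_add]
      ring
    have smul : ∀ (r : ℝ) Z, H.ricciPotential (r • Z) = r * H.ricciPotential Z := by
      intro r Z
      simp only [ricciPotential, map_smul, LinearMap.comp_smul, smul_eq_mul]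
      ring
    have had : ∀ Y, H.ricciPotential ⁅N, Y⁆
        = H.g Y (H.J N) * H.ricciPotential ⁅N, H.J N⁆ := by
      intro Y
      have hm := hN.sub_mem_maximalInvariant Y
      have h0 := hN.ricciPotential_of_mem (hN.lie_mem_maximalInvariant hm)
      rw [h _ hm, neg_zero] at h0
      have hY : ⁅N, Y⁆ = ⁅N, Y - H.g Y N • N - H.g Y (H.J N) • H.J N⁆
          + H.g Y (H.J N) • ⁅N, H.J N⁆ := by
        simp
      rw [hY, add, h0, zero_add, smul]
    -- ρ^B is a multiple of the area form of the `J`-invariant plane spanned by `N` and `JN`, hence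
    -- `J`-invariant.
    have hρ : ∀ X Y, H.bismutRicci X Y = (H.g X N * H.g Y (H.J N) - H.g Y N * H.g X (H.J N))
        * H.ricciPotential ⁅N, H.J N⁆ := by
      intro X Y
      rw [bismutRicci_eq, hN.lie_eq, sub_eq_add_neg, ← neg_smul, add, smul, smul, had Y, had X]
      ring
    rw [hρ, hρ, H.g_J_J, H.g_J_J, H.g_J_left, H.g_J_left]
    ring

end IsUnitNormal

end HermitianStructure

theorem proposition2p3 {𝔤 : Type*} [LieRing 𝔤] [LieAlgebra ℝ 𝔤] [Module.Finite ℝ 𝔤]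
    (H : HermitianStructure 𝔤) (𝔫 : LieIdeal ℝ 𝔤)
    (h_abelian : ∀ X ∈ 𝔫, ∀ Y ∈ 𝔫, ⁅X, Y⁆ = 0)
    (h_codim : Module.finrank ℝ 𝔤 = Module.finrank ℝ 𝔫 + 1) :
    (H.IsLCB ↔ H.IsTypeOneOne H.bismutRicci) ∧
    (H.IsLCB ↔ ∀ X ∈ H.maximalInvariant 𝔫.toSubmodule, ∀ Y : 𝔤, H.bismutRicci X Y = 0) := by
  obtain ⟨N, h1, h2⟩ := H.exists_unit_normal 𝔫.toSubmodule h_codim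
  have hN : H.IsUnitNormal 𝔫 N := ⟨h_abelian, h1, h2⟩
  rw [hN.isLCB_iff, hN.isTypeOneOne_bismutRicci_iff, hN.forall_bismutRicci_eq_zero_iff]
  exact ⟨Iff.rfl, Iff.rfl⟩
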